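/- **Setting.** Fix a linearly ordered set $\mathrm{PROP}$ of proposition symbols, some of which are *distinguished*. For a finite $\Pi\subseteq\mathrm{PROP}$ let $\Pi_1$ be the set of its distinguished symbols. In a Kripke model $M=(W,R,V)$ over $\Pi$ ($W\neq\emptyset$), the *local input* of a node $w$ is the string of truth values at $w$ of the symbols of $\Pi$, in increasing order, and its *identifier* is the string of truth values at $w$ of the symbols of $\Pi_1$, in increasing order. $\mathcal K(\Pi,\Delta)$ is the class of finite Kripke models over $\Pi$ in which distinct nodes have distinct identifiers and all out-degrees are at most $\Delta$. The $i$th neighbour of $w$ is its successor with the $i$th smallest identifier in the lexicographic order. *Circuits.* A Boolean circuit is a finite directed acyclic graph whose nodes (gates) are input gates (of fan-in $0$), $\wedge$- and $\vee$-gates (of any fan-in; fan-in $0$ gives the constants $1$ and $0$) or $\neg$-gates (of fan-in $1$); its output gates are the gates of fan-out $0$; input and output gates are linearly ordered. Its size is its number of gates, its depth the length of a longest path from a gate of fan-in $0$ to an output gate. A *message passing circuit* (MPC) for $(\Pi,\Delta)$ is a Boolean circuit $C$ with $|\Pi|+k(\Delta+1)$ input gates and $k$ output gates, for some $k\in\mathbb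 N$, together with sets of attention and print positions in $\{1,\dots,k\}$. On $M\in\mathcal K(\Pi,\Delta)$ it defines states $f_n(w)\in\{0,1\}^k$: with $\bar t_w$ the local input of $w$, $f_0(w)=C(\bar t_w\cdot 0^{k(\Delta+1)})$ and $f_{n+1}(w)=C(\bar t_w\cdot\bar s_0\cdots\bar s_\Delta)$, where $\bar s_0=f_n(w)$ and, for $j\ge 1$, $\bar s_j=f_n(v)$ if $v$ is the $j$th neighbour of $w$, and $\bar s_j=0^k$ if $w$ has fewer than $j$ neighbours. *Programs.* Let $V_0,V_1,\dots$ be schema variables, ordered by index. A $\Pi$-*program* of modal substitution calculus (MSC) consists of a finite nonempty set of schema variables (its head predicates), for each head predicate $Y$ a terminal clause $Y(0):=\varphi_Y$ and an iteration clause $Y:=\psi_Y$, and sets of attention and print head predicates. Here $\varphi_Y$ is built from $\top$ and symbols in $\Pi$ with $\neg,\wedge,\Diamond$, and $\psi_Y$ is built in the same way but may also use head predicates. Put $Y^0=\varphi_Y$, and let $Y^{n+1}$ be $\psi_Y$ with every head predicate $Z$ replaced by $Z^n$. The state of the program at $w$ in round $n$ is the string of truth values of the formulas $Y^n$ at $w$,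 in the order of the head predicates. The length of a program is the number of occurrences of proposition symbols, head predicates and operators $\top,\neg,\wedge,\Diamond$ in its clauses. *Output.* An MPC or a program *outputs* $\bar p$ at $w$ in round $n$ if $n$ is the first round in which some attention bit at $w$ is $1$, and $\bar p$ is the string of print bits at $w$ in round $n$. An MPC for $(\Pi,\Delta)$ and a $\Pi$-program are *(acceptance) equivalent* if for every $M\in\mathcal K(\Pi,\Delta)$ and every node $w$ of $M$, they output the same string at $w$ (possibly in different rounds) or neither outputs anything at $w$. **Theorem.** There are a constant $T$ and, for every $c\in\mathbb N$, a constant $K_c$ such that for every finite $\Pi\subseteq\mathrm{PROP}$, every $\Delta\in\mathbb N$ and every MPC $C$ for $(\Pi,\Delta)$ there is a $\Pi$-program $\Lambda$ of MSC with the following properties. 1. $\Lambda$ and $C$ are acceptance equivalent. 2. For every $c$ such that all gates of $C$ have fan-in at most $c$, the length of $\Lambda$ is at most $K_c\cdot|C|$, where $|C|$ is the size of $C$, provided that $C$ has at least one gate. 3. Whenever $C$ outputs $\bar p$ at a node $w$ of some $M\in\mathcal K(\Pi,\Delta)$ in round $n$ (that is, after the $n+1$ rounds $0,\dots,n$), $\Lambda$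 outputs $\bar p$ at $w$ in some round $n'$ with $n'+1\le T\,(d+2^{|\Pi_1|})\,(n+1)$, where $d$ is the depth of $C$. -/

import Mathlib

universe u v

/-! ### Bit sequences: acceptance and output -/

/-- The sequence `S` of bit strings, with positions in `ι`, accepts in round `n` with respect to
the set `A` of attention positions: some attention bit is `1` in round `n`, and all attention bits
are `0` in all earlier rounds. -/
def AcceptsAt {ι : Type*} (S : ℕ → ι → Bool) (A : Finset ι) (n : ℕ) : Prop :=
  (∃ a ∈ A, S n a = true) ∧ ∀ m < n, ∀ a ∈ A, S m a = false

/-- The substring of the bit string `b` with positions in `P`, read in increasing order. -/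
def substring {ι : Type*} [LinearOrder ι] (b : ι → Bool) (P : Finset ι) : List Bool :=
  (P.sort (· ≤ ·)).map b

/-- The sequence `S` accepts in round `n`, and its string of print bits in that round is `s`. -/
def OutputsAt {ι : Type*} [LinearOrder ι] (S : ℕ → ι → Bool) (A P : Finset ι) (n : ℕ)
    (s : List Bool) : Prop :=
  AcceptsAt S A n ∧ s = substring (S n) P

/-! ### Kripke models with identifiers -/

section Kripke

open Classical in
/-- The distinguished (identifier) propositions among `Π`, where `ID` is the set of all
distinguished proposition symbols. -/
noncomputable def distinguished {PROP : Type v} (ID : Set PROP) (Pi : Finset PROP) :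
    Finset PROP :=
  Pi.filter (· ∈ ID)

theorem mem_of_mem_distinguished {PROP : Type v} {ID : Set PROP} {Pi : Finset PROP} {p : PROP}
    (h : p ∈ distinguished ID Pi) : p ∈ Pi := by
  classical
  rw [distinguished, Finset.mem_filter] at h
  exact h.1

variable {PROP : Type v} [LinearOrder PROP]

/-- A Kripke model interpreting precisely the proposition symbols in `Π`. -/
structure KripkeModel (Pi : Finset PROP) where
  W : Type u
  nonempty : Nonempty W
  R : W → W → Prop
  V : Pi → Set W

namespace KripkeModel

variable {Pi : Finset PROP} (M : KripkeModel.{u} Pi)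

open Classical in
/-- The local input of `w`: its `i`th bit is the truth value at `w` of the `i`th symbol of `Π`. -/
noncomputable def localInput (w : M.W) : Fin Pi.card → Bool := fun i =>
  decide (w ∈ M.V (Pi.orderIsoOfFin rfl i))

open Classical in
/-- The identifier of `w`: its `i`th bit is the truth value at `w` of the `i`th distinguished
symbol of `Π`. Identifiers are compared lexicographically (the first bit is the most significant
one, and `0 < 1`). -/
noncomputable def ident (ID : Set PROP) (w : M.W) :
    Lex (Fin (distinguished ID Pi).card → Bool) :=
  toLex fun i => decide (w ∈ M.V
    ⟨(distinguished ID Pi).orderEmbOfFin rfl i,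
      mem_of_mem_distinguished ((distinguished ID Pi).orderEmbOfFin_mem rfl i)⟩)

/-- The set of successors of `w`. -/
def succ (w : M.W) : Set M.W := {x | M.R w x}

/-- `x` is the `i`th neighbour of `w` (counting from `1`): a successor of `w` such that exactly
`i - 1` successors of `w` have a lexicographically smaller identifier. -/
def IsNeighbour (ID : Set PROP) (w : M.W) (i : ℕ) (x : M.W) : Prop :=
  x ∈ M.succ w ∧ {y ∈ M.succ w | M.ident ID y < M.ident ID x}.ncard + 1 = i

/-- Membership in the class `K(Π, Δ)` of finite Kripke models over `Π` with identifiers in which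
all out-degrees are at most `Δ`. -/
structure MemK (ID : Set PROP) (Delta : ℕ) : Prop where
  finite : Finite M.W
  ident_injective : Function.Injective (M.ident ID)
  outDegree_le : ∀ w, (M.succ w).ncard ≤ Delta

end KripkeModel

end Kripke

/-! ### Modal substitution calculus -/

/-- Schemata with proposition symbols from `P` and schema variables from `T`. -/
inductive Schema (P : Type u) (T : Type v) : Type (max u v)
  | top : Schema P T
  | prop (p : P) : Schema P T
  | var (X : T) : Schema P T
  | neg (φ : Schema P T) : Schema P T
  | and (φ ψ : Schema P T) : Schema P T
  | dia (φ : Schema P T) : Schema P T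

/-- Formulas of basic modal logic: schemata without schema variables. -/
abbrev ML (P : Type u) := Schema P Empty

namespace Schema

/-- Simultaneous replacement of all schema variables. -/
def subst {P : Type*} {T : Type*} {T' : Type*} (σ : T → Schema P T') :
    Schema P T → Schema P T'
  | top => top
  | prop p => prop p
  | var X => σ X
  | neg φ => neg (φ.subst σ)
  | and φ ψ => and (φ.subst σ) (ψ.subst σ)
  | dia φ => dia (φ.subst σ)

/-- Number of occurrences of proposition symbols, schema variables and operators. -/
def length {P : Type*} {T : Type*} : Schema P T → ℕ
  | top => 1
  | prop _ => 1
  | var _ => 1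
  | neg φ => φ.length + 1
  | and φ ψ => φ.length + ψ.length + 1
  | dia φ => φ.length + 1

end Schema

/-- Truth of a modal formula at a node. -/
def KripkeModel.Sat {PROP : Type v} [LinearOrder PROP] {Pi : Finset PROP}
    (M : KripkeModel.{u} Pi) : M.W → ML Pi → Prop
  | _, .top => True
  | w, .prop p => w ∈ M.V p
  | w, .neg φ => ¬ M.Sat w φ
  | w, .and φ ψ => M.Sat w φ ∧ M.Sat w ψ
  | w, .dia φ => ∃ x, M.R w x ∧ M.Sat x φ

/-- A `Π`-program of MSC. The schema variable `V_i` is represented by `i : ℕ`, with the usual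
order. -/
structure MSCProgram {PROP : Type v} (Pi : Finset PROP) where
  /-- the finite nonempty set of head predicates -/
  head : Finset ℕ
  head_nonempty : head.Nonempty
  /-- bodies of the terminal clauses -/
  terminal : head → ML Pi
  /-- bodies of the iteration clauses -/
  iteration : head → Schema Pi head
  /-- attention predicates -/
  attention : Finset head
  /-- print predicates -/
  print : Finset head

namespace MSCProgram

variable {PROP : Type v} {Pi : Finset PROP} (L : MSCProgram Pi)

/-- The `n`th iteration formula of each head predicate. -/
def iterFormula : ℕ → L.head → ML Pi
  | 0, Y => L.terminal Y
  | n + 1, Y => (L.iteration Y).subst (iterFormula n)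

/-- The length of a program: the number of occurrences of proposition symbols, head predicates and
operators. Each head predicate occurs once to the left of `:=` in its terminal clause and once in
its iteration clause. -/
def length : ℕ :=
  ∑ Y : L.head, ((1 + (L.terminal Y).length) + (1 + (L.iteration Y).length))

variable [LinearOrder PROP]

open Classical in
/-- The global configuration of round `n`: the bit of the head predicate `Y` at `w` is the truth
value of the `n`th iteration formula of `Y`. -/
noncomputable def config (M : KripkeModel.{u} Pi) (w : M.W) (n : ℕ) : L.head → Bool :=
  fun Y => decide (M.Sat w (L.iterFormula n Y))

/-- The program outputs the string `s` at `w` in round `n`. -/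
def Outputs (M : KripkeModel.{u} Pi) (w : M.W) (n : ℕ) (s : List Bool) : Prop :=
  OutputsAt (L.config M w) L.attention L.print n s

end MSCProgram

/-! ### Boolean circuits -/

inductive GateKind
  | input
  | and
  | or
  | not

/-- A Boolean circuit with `n` input gates and `k` output gates, both linearly ordered. The gates
are the elements of `Fin size`, and `child g` is the set of gates with an edge to `g`. Gates labeled
`and` or `or` may have fan-in zero; they are then constants. -/
structure Circuit (n k : ℕ) where
  /-- number of gates -/
  size : ℕ
  kind : Fin size → GateKind
  child : Fin size → Finset (Fin size)
  acyclic : ∀ g, ¬ Relation.TransGen (fun h g => h ∈ child g) g g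
  child_input : ∀ g, kind g = GateKind.input → child g = ∅
  child_not : ∀ g, kind g = GateKind.not → (child g).card = 1
  /-- the input gates in order -/
  inputs : Fin n ≃ {g // kind g = GateKind.input}
  /-- the output gates (those of fan-out zero) in order -/
  outputs : Fin k ≃ {g : Fin size // ∀ h, g ∉ child h}

namespace Circuit

variable {n k : ℕ} (C : Circuit n k)

theorem wf : WellFounded (fun h g => h ∈ C.child g) := by
  have : Std.Irrefl (Relation.TransGen (fun h g => h ∈ C.child g)) := ⟨C.acyclic⟩
  exact Subrelation.wf (fun h => Relation.TransGen.single h)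
    (Finite.wellFounded_of_trans_of_irrefl (Relation.TransGen (fun h g => h ∈ C.child g)))

/-- The value of a gate on the input string `x`. In `Bool`, where `false < true`, the infimum of a
finite family is its conjunction (`true` if empty) and the supremum is its disjunction (`false` if
empty). -/
noncomputable def value (x : Fin n → Bool) (g : Fin C.size) : Bool :=
  match hk : C.kind g with
  | .input => x (C.inputs.symm ⟨g, hk⟩)
  | .and => (C.child g).attach.inf fun h => value x h.1
  | .or => (C.child g).attach.sup fun h => value x h.1
  | .not => !((C.child g).attach.sup fun h => value x h.1)
termination_by C.wf.wrap g
decreasing_by all_goals exact h.2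

/-- The function computed by the circuit. -/
noncomputable def eval (x : Fin n → Bool) : Fin k → Bool := fun i => C.value x (C.outputs i)

/-- The height of a gate: the length of a longest path from a gate of fan-in zero to it. -/
def height (g : Fin C.size) : ℕ :=
  (C.child g).attach.sup fun h => height h.1 + 1
termination_by C.wf.wrap g
decreasing_by exact h.2

/-- The depth: the length of a longest path from a gate of fan-in zero to an output gate. -/
def depth : ℕ := Finset.univ.sup fun i : Fin k => C.height (C.outputs i)

/-- All gates have fan-in at most `c`. -/
def FanInLE (c : ℕ) : Prop := ∀ g, (C.child g).card ≤ c

end Circuit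

/-! ### Message passing circuits -/

/-- A message passing circuit for `(Π, Δ)`. -/
structure MPC {PROP : Type v} (Pi : Finset PROP) (Delta : ℕ) where
  /-- state length -/
  k : ℕ
  circuit : Circuit (Pi.card + (Delta + 1) * k) k
  /-- attention bits -/
  attention : Finset (Fin k)
  /-- print bits -/
  print : Finset (Fin k)

namespace MPC

variable {PROP : Type v} [LinearOrder PROP] {Pi : Finset PROP} {Delta : ℕ} (C : MPC Pi Delta)

/-- The concatenation `t · s 0 ⋯ s Δ`. -/
def inputString (t : Fin Pi.card → Bool) (s : Fin (Delta + 1) → Fin C.k → Bool) :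
    Fin (Pi.card + (Delta + 1) * C.k) → Bool :=
  Fin.append t fun i => s (finProdFinEquiv.symm i).1 (finProdFinEquiv.symm i).2

open Classical in
/-- The strings received by `w` if the current global configuration is `f`: string `0` is the state
of `w`, string `j ≥ 1` is the state of the `j`th neighbour of `w`, or `0 ⋯ 0` if there is none. -/
noncomputable def received (ID : Set PROP) (M : KripkeModel.{u} Pi) (f : M.W → Fin C.k → Bool)
    (w : M.W) (j : Fin (Delta + 1)) (b : Fin C.k) : Bool :=
  if (j : ℕ) = 0 then f w b else decide (∃ x, M.IsNeighbour ID w j x ∧ f x b = true)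

/-- The global configuration of round `n`. -/
noncomputable def config (ID : Set PROP) (M : KripkeModel.{u} Pi) : ℕ → M.W → Fin C.k → Bool
  | 0, w => C.circuit.eval (C.inputString (M.localInput w) fun _ _ => false)
  | n + 1, w =>
      C.circuit.eval (C.inputString (M.localInput w) (C.received ID M (config ID M n) w))

/-- The circuit outputs the string `s` at `w` in round `n`. -/
def Outputs (ID : Set PROP) (M : KripkeModel.{u} Pi) (w : M.W) (n : ℕ) (s : List Bool) : Prop :=
  OutputsAt (fun m => C.config ID M m w) C.attention C.print n s

/-- Acceptance equivalence of an MPC for `(Π, Δ)` and a `Π`-program: on every model suitable for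
both and at every node, they produce the same output or neither produces an output. -/
def Equivalent (ID : Set PROP) (L : MSCProgram Pi) : Prop :=
  ∀ M : KripkeModel.{u} Pi, M.MemK ID Delta → ∀ (w : M.W) (s : List Bool),
    (∃ n, C.Outputs ID M w n s) ↔ ∃ n, L.Outputs M w n s

end MPC

/-!
The program simulates each communication round of the circuit in a period of
`(depth + 2) + (m + 2 ^ m)` steps, where `m` is the number of distinguished symbols. First a pulse
travels through a delay chain while the gates, which are recomputed in every step from the values of
their children, settle: a gate of height `h` is right after `h + 1` steps with constant input. Then
a binary counter runs through all identifiers. A node is called when the counter reaches its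
identifier, and its predecessors notice this through `◇`; so every node meets its successors in the
order of their identifiers, counts them with flags, and stores the state of the `j`th one in slot
`j`. Clauses of bounded length cannot propagate a carry through the whole counter in one step, so
bit `i` runs `i` steps late, which accounts for the summand `m`.
-/

/-! ### Output sequences under reindexing and time dilation -/

section OutputsAt

variable {α β : Type*} [LinearOrder α] [LinearOrder β]

theorem substring_map (f : α ↪o β) (b : β → Bool) (P : Finset α) :
    substring b (P.map f.toEmbedding) = substring (fun a => b (f a)) P := by
  have hsort : (P.sort (· ≤ ·)).map f = (P.map f.toEmbedding).sort (· ≤ ·) :=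
    Finset.map_sort f.toEmbedding P (· ≤ ·) (· ≤ ·) fun _ _ _ _ => f.le_iff_le.symm
  rw [substring, substring, ← hsort, List.map_map, Function.comp_def]

theorem outputsAt_map (f : α ↪o β) {S : ℕ → β → Bool} {A P : Finset α} {n : ℕ} {s : List Bool} :
    OutputsAt S (A.map f.toEmbedding) (P.map f.toEmbedding) n s ↔
      OutputsAt (fun n a => S n (f a)) A P n s := by
  simp only [OutputsAt, AcceptsAt, substring_map, Finset.mem_map, exists_exists_and_eq_and,
    forall_exists_index, and_imp, forall_apply_eq_imp_iff₂, RelEmbedding.coe_toEmbedding]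

variable {S S' : ℕ → α → Bool} {A P : Finset α} {a Q n : ℕ} {s : List Bool}

theorem outputsAt_add_mul (hQ : 0 < Q) (h_lt : ∀ t < a, ∀ i, S' t i = false)
    (h_add : ∀ t, S' (a + t) = S (t / Q)) (h : OutputsAt S A P n s) :
    OutputsAt S' A P (a + n * Q) s := by
  have hn : S' (a + n * Q) = S n := by rw [h_add, Nat.mul_div_cancel _ hQ]
  obtain ⟨⟨hacc, hearlier⟩, rfl⟩ := h
  refine ⟨⟨hn ▸ hacc, fun t ht i hi => ?_⟩, by rw [hn]⟩
  obtain hta | ⟨r, rfl⟩ := (lt_or_ge t a).imp_right Nat.exists_eq_add_of_le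
  · exact h_lt t hta i
  · rw [h_add]
    exact hearlier _ ((Nat.div_lt_iff_lt_mul hQ).2 (Nat.add_lt_add_iff_left.1 ht)) i hi

theorem exists_outputsAt_of_dilation (hQ : 0 < Q) (h_lt : ∀ t < a, ∀ i, S' t i = false)
    (h_add : ∀ t, S' (a + t) = S (t / Q)) (h : OutputsAt S' A P n s) :
    ∃ m, OutputsAt S A P m s := by
  obtain ⟨⟨⟨i, hi, hi_true⟩, hearlier⟩, rfl⟩ := h
  obtain hna | ⟨r, rfl⟩ := (lt_or_ge n a).imp_right Nat.exists_eq_add_of_le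
  · simp [h_lt n hna i] at hi_true
  refine ⟨r / Q, ⟨⟨i, hi, h_add r ▸ hi_true⟩, fun m hm j hj => ?_⟩, by rw [h_add]⟩
  have hm_lt : a + m * Q < a + r :=
    Nat.add_lt_add_left (Nat.lt_of_lt_of_le (Nat.mul_lt_mul_of_pos_right hm hQ)
      (Nat.div_mul_le_self r Q)) a
  simpa only [h_add, Nat.mul_div_cancel _ hQ] using hearlier _ hm_lt j hj

end OutputsAt

/-! ### Schemata -/

namespace Schema

section Connectives

variable {P T α : Type*}

/-- Disjunction, as an abbreviation in terms of the primitive connectives. -/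
def or (φ ψ : Schema P T) : Schema P T := neg (and (neg φ) (neg ψ))

/-- Case distinction: `ψ` where `φ` holds, and `χ` elsewhere. -/
def cond (φ ψ χ : Schema P T) : Schema P T := or (and φ ψ) (and (neg φ) χ)

/-- Conjunction of a finite family of schemata, in an unspecified order. -/
noncomputable def conj (s : Finset α) (f : α → Schema P T) : Schema P T :=
  (s.toList.map f).foldr and top

/-- Disjunction of a finite family of schemata, in an unspecified order. -/
noncomputable def disj (s : Finset α) (f : α → Schema P T) : Schema P T :=
  neg (conj s fun a => neg (f a))

theorem length_or (φ ψ : Schema P T) : (or φ ψ).length = φ.length + ψ.length + 4 := by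
  simp only [or, length]; omega

theorem length_cond (φ ψ χ : Schema P T) :
    (cond φ ψ χ).length = 2 * φ.length + ψ.length + χ.length + 7 := by
  simp only [cond, length_or, length]; omega

theorem length_conj (s : Finset α) (f : α → Schema P T) :
    (conj s f).length = ∑ a ∈ s, ((f a).length + 1) + 1 := by
  rw [conj, ← Finset.sum_map_toList]
  induction s.toList with
  | nil => rfl
  | cons a l ih =>
    simp only [List.map_cons, List.foldr_cons, List.sum_cons, length, ih]
    omega

theorem length_disj (s : Finset α) (f : α → Schema P T) :
    (disj s f).length = ∑ a ∈ s, ((f a).length + 2) + 2 := by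
  simp only [disj, length, length_conj]

theorem length_subst_var {T' : Type*} (f : T → T') (φ : Schema P T) :
    (φ.subst fun X => var (f X)).length = φ.length := by
  induction φ <;> simp only [subst, length, *]

end Connectives

section Holds

variable {PROP : Type v} {Pi : Finset PROP} (M : KripkeModel.{u} Pi) {T T' α : Type*}

/-- Truth of a schema at a node, relative to an interpretation `val` of the schema variables. -/
@[simp]
def Holds (val : T → M.W → Prop) : Schema Pi T → M.W → Prop
  | top, _ => True
  | prop p, w => w ∈ M.V p
  | var X, w => val X w
  | neg φ, w => ¬ φ.Holds val w
  | and φ ψ, w => φ.Holds val w ∧ ψ.Holds val w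
  | dia φ, w => ∃ x, M.R w x ∧ φ.Holds val x

theorem sat_subst [LinearOrder PROP] (σ : T → ML Pi) (φ : Schema Pi T) (w : M.W) :
    M.Sat w (φ.subst σ) ↔ φ.Holds M (fun X x => M.Sat x (σ X)) w := by
  induction φ generalizing w <;> simp_all [subst, KripkeModel.Sat]

theorem holds_subst_var (f : T → T') (val : T' → M.W → Prop) (φ : Schema Pi T) (w : M.W) :
    (φ.subst fun X => var (f X)).Holds M val w ↔ φ.Holds M (fun X => val (f X)) w := by
  induction φ generalizing w <;> simp_all [subst]

variable {M} {val : T → M.W → Prop} {w : M.W} {φ ψ χ : Schema Pi T}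

@[simp]
theorem holds_or : (or φ ψ).Holds M val w ↔ φ.Holds M val w ∨ ψ.Holds M val w := by
  simp only [or, Holds]; tauto

@[simp]
theorem holds_cond : (cond φ ψ χ).Holds M val w ↔
    (φ.Holds M val w ∧ ψ.Holds M val w) ∨ (¬ φ.Holds M val w ∧ χ.Holds M val w) := by
  simp only [cond, holds_or, Holds]

@[simp]
theorem holds_conj {s : Finset α} {f : α → Schema Pi T} :
    (conj s f).Holds M val w ↔ ∀ a ∈ s, (f a).Holds M val w := by
  simp only [conj, ← Finset.mem_toList]
  induction s.toList <;> simp_all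

@[simp]
theorem holds_disj {s : Finset α} {f : α → Schema Pi T} :
    (disj s f).Holds M val w ↔ ∃ a ∈ s, (f a).Holds M val w := by
  simp [disj]

end Holds

end Schema

/-! ### Clause systems -/

/-- The clauses of an MSC program whose schema variables form an arbitrary type `ι` instead of a
set of natural numbers. Attention and print variables are chosen later, in
`ClauseSystem.toProgram`. -/
structure ClauseSystem {PROP : Type v} (Pi : Finset PROP) (ι : Type*) where
  terminal : ι → ML Pi
  iteration : ι → Schema Pi ι

/-- The clauses of a program, as a system over its own head predicates. -/
def MSCProgram.clauses {PROP : Type v} {Pi : Finset PROP} (L : MSCProgram Pi) :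
    ClauseSystem Pi L.head :=
  ⟨L.terminal, L.iteration⟩

namespace ClauseSystem

section Semantics

variable {PROP : Type v} [LinearOrder PROP] {Pi : Finset PROP} (M : KripkeModel.{u} Pi)
  {ι κ : Type*}

/-- Truth in round `n` of the iteration formula of a variable. It is computed from the truth values
in round `n - 1`, so that iteration formulas need not be unfolded. -/
def Holds (S : ClauseSystem Pi ι) : ℕ → ι → M.W → Prop
  | 0, X, w => M.Sat w (S.terminal X)
  | n + 1, X, w => (S.iteration X).Holds M (S.Holds n) w

theorem sat_iterFormula_iff (L : MSCProgram Pi) (n : ℕ) (Y : L.head) (w : M.W) :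
    M.Sat w (L.iterFormula n Y) ↔ L.clauses.Holds M n Y w := by
  induction n generalizing Y w with
  | zero => rfl
  | succ n ih => simp only [MSCProgram.iterFormula, Schema.sat_subst, ih, Holds]; rfl

theorem holds_map_iff {S : ClauseSystem Pi ι} {S' : ClauseSystem Pi κ} (f : ι → κ)
    (h_terminal : ∀ X, S'.terminal (f X) = S.terminal X)
    (h_iteration : ∀ X, S'.iteration (f X) = (S.iteration X).subst fun Y => .var (f Y))
    (n : ℕ) (X : ι) (w : M.W) : S'.Holds M n (f X) w ↔ S.Holds M n X w := by
  induction n generalizing X w with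
  | zero => simp only [Holds, h_terminal]
  | succ n ih =>
    have hn : (fun Y => S'.Holds M n (f Y)) = S.Holds M n := funext₂ fun Y x => propext (ih Y x)
    simp only [Holds, h_iteration, Schema.holds_subst_var, hn]

end Semantics

section ToProgram

theorem exists_numbering_strictMono {ι : Type*} [Countable ι] {k : ℕ} (f : Fin k ↪ ι) :
    ∃ e : ι ↪ ℕ, StrictMono fun a => e (f a) := by
  obtain ⟨g, hg⟩ := exists_injective_nat ι
  let e : ι → ℕ := Function.extend f (fun a => a) fun i => k + g i
  have he (a : Fin k) : e (f a) = a := f.injective.extend_apply _ _ a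
  have he' {i : ι} (hi : ¬ ∃ a, f a = i) : e i = k + g i := Function.extend_apply' _ _ i hi
  have he_inj : Function.Injective e := fun i j hij => by
    by_cases hi : ∃ a, f a = i <;> by_cases hj : ∃ a, f a = j
    · obtain ⟨⟨a, rfl⟩, b, rfl⟩ := And.intro hi hj
      rw [he, he] at hij
      rw [Fin.ext hij]
    · obtain ⟨a, rfl⟩ := hi
      rw [he, he' hj] at hij
      omega
    · obtain ⟨b, rfl⟩ := hj
      rw [he, he' hi] at hij
      omega
    · rw [he' hi, he' hj] at hij
      exact hg (Nat.add_left_cancel hij)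
  exact ⟨⟨e, he_inj⟩, fun a b hab => by simpa [he] using hab⟩

variable {ι α : Type*} [Fintype ι]

/-- Identifies variables with the head predicates that represent them under the numbering `e`. -/
noncomputable def headEquiv (e : ι ↪ ℕ) : ι ≃ (Finset.univ.map e : Finset ℕ) :=
  (Equiv.ofInjective e e.injective).trans (Equiv.subtypeEquivRight (by simp))

variable {PROP : Type v} {Pi : Finset PROP} [Nonempty ι]

/-- The program obtained from a system of clauses by numbering its variables. -/
noncomputable def toProgram (S : ClauseSystem Pi ι) (e : ι ↪ ℕ) (A P : Finset ι) :
    MSCProgram Pi where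
  head := Finset.univ.map e
  head_nonempty := Finset.univ_nonempty.map
  terminal Y := S.terminal ((headEquiv e).symm Y)
  iteration Y := (S.iteration ((headEquiv e).symm Y)).subst fun X => .var (headEquiv e X)
  attention := A.map (headEquiv e).toEmbedding
  print := P.map (headEquiv e).toEmbedding

theorem length_toProgram (S : ClauseSystem Pi ι) (e : ι ↪ ℕ) (A P : Finset ι) :
    (S.toProgram e A P).length =
      ∑ X, ((1 + (S.terminal X).length) + (1 + (S.iteration X).length)) := by
  rw [← (headEquiv e).symm.sum_comp]
  refine Finset.sum_congr rfl fun Y _ => ?_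
  simp only [toProgram, Schema.length_subst_var]

variable [LinearOrder PROP]

theorem holds_clauses_toProgram_iff (S : ClauseSystem Pi ι) (e : ι ↪ ℕ) (A P : Finset ι)
    (M : KripkeModel.{u} Pi) (n : ℕ) (X : ι) (w : M.W) :
    (S.toProgram e A P).clauses.Holds M n (headEquiv e X) w ↔ S.Holds M n X w :=
  holds_map_iff M (headEquiv e) (fun X => by simp [MSCProgram.clauses, toProgram])
    (fun X => by simp [MSCProgram.clauses, toProgram]) n X w

variable [LinearOrder α]

open Classical in
theorem outputs_toProgram_iff (S : ClauseSystem Pi ι) {e : ι ↪ ℕ} {f : α ↪ ι}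
    (hf : StrictMono fun a => e (f a)) {A P : Finset α} {M : KripkeModel.{u} Pi} {w : M.W} {n : ℕ}
    {s : List Bool} : (S.toProgram e (A.map f) (P.map f)).Outputs M w n s ↔
      OutputsAt (fun t a => decide (S.Holds M t (f a) w)) A P n s := by
  let L := S.toProgram e (A.map f) (P.map f)
  let F : α ↪o L.head := OrderEmbedding.ofStrictMono (fun a => headEquiv e (f a)) hf
  have hA : L.attention = A.map F.toEmbedding := Finset.map_map ..
  have hP : L.print = P.map F.toEmbedding := Finset.map_map ..
  have hholds (t : ℕ) (a : α) : L.clauses.Holds M t (F a) w ↔ S.Holds M t (f a) w :=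
    S.holds_clauses_toProgram_iff e _ _ M t (f a) w
  change OutputsAt (L.config M w) L.attention L.print n s ↔ _
  rw [hA, hP, outputsAt_map]
  simp only [MSCProgram.config, sat_iterFormula_iff, hholds]

end ToProgram

end ClauseSystem

/-! ### Binary representations -/

section Binary

variable {a b i n m : ℕ}

theorem forall_testBit_eq_iff_mod_two_pow_eq :
    (∀ j < i, a.testBit j = b.testBit j) ↔ a % 2 ^ i = b % 2 ^ i := by
  rw [Nat.eq_iff_testBit_eq]
  refine forall_congr' fun j => ?_
  by_cases hj : j < i <;> simp [Nat.testBit_mod_two_pow, hj]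

theorem forall_testBit_eq_iff_of_lt (ha : a < 2 ^ m) (hb : b < 2 ^ m) :
    (∀ j < m, a.testBit j = b.testBit j) ↔ a = b := by
  rw [forall_testBit_eq_iff_mod_two_pow_eq, Nat.mod_eq_of_lt ha, Nat.mod_eq_of_lt hb]

theorem forall_testBit_iff_dvd_succ : (∀ j < i, n.testBit j = true) ↔ 2 ^ i ∣ n + 1 := by
  have h_ones : (∀ j < i, n.testBit j = true) ↔ ∀ j < i, n.testBit j = (2 ^ i - 1).testBit j :=
    forall₂_congr fun j hj => by simp [Nat.testBit_two_pow_sub_one, hj]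
  rw [h_ones, forall_testBit_eq_iff_mod_two_pow_eq, ← Nat.ModEq, ← Nat.ModEq.add_iff_right .rfl,
    Nat.sub_add_cancel Nat.one_le_two_pow]
  simp [Nat.ModEq, Nat.dvd_iff_mod_eq_zero]

theorem forall_testBit_iff_of_lt (h : n < 2 ^ m) :
    (∀ j < m, n.testBit j = true) ↔ n + 1 = 2 ^ m := by
  rw [forall_testBit_iff_dvd_succ]
  exact ⟨fun hd => le_antisymm h (Nat.le_of_dvd n.succ_pos hd), fun h => h ▸ dvd_rfl⟩

theorem testBit_succ_iff_not_iff_forall : (n + 1).testBit i = true ↔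
    ¬ (n.testBit i = true ↔ ∀ j < i, n.testBit j = true) := by
  rw [forall_testBit_iff_dvd_succ]
  simp only [Nat.testBit_eq_decide_div_mod_eq, Nat.succ_div, decide_eq_true_eq]
  split_ifs with h_dvd <;> simp only [h_dvd] <;> grind

theorem strictMono_ofBits_rev (m : ℕ) :
    StrictMono fun a : Lex (Fin m → Bool) => Nat.ofBits fun i => ofLex a i.rev := by
  rintro a b ⟨i, h_agree, h_lt⟩
  obtain ⟨ha, hb⟩ : ofLex a i = false ∧ ofLex b i = true := Bool.lt_iff.1 h_lt
  refine Nat.lt_of_testBit i.rev ?_ ?_ fun j hj => ?_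
  · rw [Nat.testBit_ofBits_lt _ _ i.rev.2, Fin.eta, Fin.rev_rev, ha]
  · rw [Nat.testBit_ofBits_lt _ _ i.rev.2, Fin.eta, Fin.rev_rev, hb]
  obtain hjm | hmj := lt_or_ge j m
  · have h_rev : (⟨j, hjm⟩ : Fin m).rev < i := Fin.rev_lt_iff.2 hj
    simpa [Nat.testBit_ofBits_lt, hjm] using h_agree _ h_rev
  · simp [Nat.testBit_ofBits_ge, hmj]

end Binary

/-! ### The clock -/

/-- The variables of `clock p`. -/
inductive ClockVar (d m : ℕ)
  /-- position `i` of the delay chain -/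
  | delay (i : Fin (d + 1))
  /-- bit `i` of the counter -/
  | bit (i : Fin m)
  /-- all bits below bit `i` are `1`, so that bit `i` is about to flip -/
  | carry (i : Fin (m + 1))
  /-- the counter agrees with the number of the node on all bits below bit `i` -/
  | agree (i : Fin (m + 1))

namespace ClockVar

variable {d m : ℕ}

/-- The four kinds of variables as summands, which is how the variables are counted. -/
def equivSum (d m : ℕ) :
    ClockVar d m ≃ (Fin (d + 1) ⊕ Fin m) ⊕ (Fin (m + 1) ⊕ Fin (m + 1)) where
  toFun
    | delay i => .inl (.inl i)
    | bit i => .inl (.inr i)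
    | carry i => .inr (.inl i)
    | agree i => .inr (.inr i)
  invFun := Sum.elim (Sum.elim delay bit) (Sum.elim carry agree)
  left_inv X := by cases X <;> rfl
  right_inv := by rintro ((i | i) | (i | i)) <;> rfl

instance : Fintype (ClockVar d m) := .ofEquiv _ (equivSum d m).symm

/-- The variable that is true when the pulse leaves the delay chain. -/
abbrev pulse : ClockVar d m := delay (Fin.last d)

/-- The variable that is true when the counter is about to overflow. -/
abbrev overflow : ClockVar d m := carry (Fin.last m)

/-- The variable that is true when the counter agrees with the number of the node. -/
abbrev called : ClockVar d m := agree (Fin.last m)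

theorem card (d m : ℕ) : Fintype.card (ClockVar d m) = (d + 1) + m + 2 * (m + 1) := by
  rw [Fintype.card_congr (equivSum d m)]
  simp only [Fintype.card_sum, Fintype.card_fin]
  omega

end ClockVar

open Schema ClockVar in
/-- A clock that is periodic with period `clockPeriod d m`: a pulse travels through a delay chain,
and then starts a binary counter which runs until it overflows and emits the next pulse. In order
that every clause has bounded length, carries and comparisons advance by one bit per time step, so
bit `i` of the counter lags behind by `i` steps. A node is called when the counter reaches the
number whose binary representation is given by the symbols `p`. -/
def clock {PROP : Type v} {Pi : Finset PROP} {m : ℕ} (d : ℕ) (p : Fin m → Pi) :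
    ClauseSystem Pi (ClockVar d m) where
  terminal
    | delay i => Fin.cases (motive := fun _ => ML Pi) top (fun _ => neg top) i
    | _ => neg top
  iteration
    | delay i => Fin.cases (motive := fun _ => Schema Pi _) (var overflow)
        (fun i => var (delay i.castSucc)) i
    | bit i => and (neg (var overflow))
        (cond (var (carry i.castSucc)) (neg (var (bit i))) (var (bit i)))
    | carry i => and (neg (var overflow)) (Fin.cases (motive := fun _ => Schema Pi _)
        (or (var (carry 0)) (var pulse)) (fun i => and (var (bit i)) (var (carry i.castSucc))) i)
    | agree i => and (neg (var overflow)) (Fin.cases (motive := fun _ => Schema Pi _)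
        (or (var (agree 0)) (var pulse))
        (fun i => and (var (agree i.castSucc)) (cond (var (bit i)) (prop (p i)) (neg (prop (p i)))))
        i)

section Length

variable {PROP : Type v} {Pi : Finset PROP} {d m : ℕ} (p : Fin m → Pi) (X : ClockVar d m)

theorem length_terminal_clock_le : ((clock d p).terminal X).length ≤ 2 := by
  cases X with
  | delay i => cases i using Fin.cases <;> simp [clock, Schema.length]
  | _ => simp [clock, Schema.length]

theorem length_iteration_clock_le : ((clock d p).iteration X).length ≤ 17 := by
  cases X with
  | bit i => simp [clock, Schema.length, Schema.length_cond]
  | _ i =>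
    cases i using Fin.cases <;>
      simp [clock, Schema.length, Schema.length_cond, Schema.length_or]

end Length

/-- The period of `clock p`: `d + 1` steps in the delay chain, and `2 ^ m` steps of the counter,
the last bits of which are delayed by `m` steps. -/
def clockPeriod (d m : ℕ) : ℕ := d + 1 + (m + 2 ^ m)

theorem clockPeriod_pos (d m : ℕ) : 0 < clockPeriod d m :=
  Nat.add_pos_left d.succ_pos _

open Classical in
/-- The number whose binary digits, beginning with the least significant one, are the truth values
of the symbols `p` at `w`. -/
noncomputable def KripkeModel.binaryNum {PROP : Type v} [LinearOrder PROP] {Pi : Finset PROP}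
    (M : KripkeModel.{u} Pi) {m : ℕ} (p : Fin m → Pi) (w : M.W) : ℕ :=
  Nat.ofBits fun i => decide (w ∈ M.V (p i))

section Clock

variable {PROP : Type v} [LinearOrder PROP] {Pi : Finset PROP} (M : KripkeModel.{u} Pi)
  {d m t : ℕ} (p : Fin m → Pi)

namespace KripkeModel

variable (w : M.W)

theorem binaryNum_lt : M.binaryNum p w < 2 ^ m := Nat.ofBits_lt_two_pow _

theorem testBit_binaryNum_iff (i : Fin m) :
    (M.binaryNum p w).testBit i = true ↔ w ∈ M.V (p i) := by
  rw [binaryNum, Nat.testBit_ofBits_lt _ _ i.2]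
  exact @decide_eq_true_iff _ (Classical.propDecidable _)

end KripkeModel

namespace ClockVar

/-- The truth value of a clock variable `t` steps after the beginning of a period. Truncated
subtraction keeps the bits at `0` until the pulse has left the delay chain. -/
def HoldsAt (t : ℕ) : ClockVar d m → M.W → Prop
  | delay i, _ => t = i
  | bit i, _ => (t - (d + 1 + i)).testBit i = true
  | carry i, _ => d + 1 + i ≤ t ∧ ∀ j < (i : ℕ), (t - (d + 1 + i)).testBit j = true
  | agree i, w => d + 1 + i ≤ t ∧
      ∀ j < (i : ℕ), (t - (d + 1 + i)).testBit j = (M.binaryNum p w).testBit j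

variable (w : M.W)

theorem holdsAt_overflow_iff (ht : t < clockPeriod d m) :
    (overflow : ClockVar d m).HoldsAt M p t w ↔ t + 1 = clockPeriod d m := by
  have hpos := Nat.two_pow_pos m
  simp only [HoldsAt, Fin.val_last, clockPeriod] at ht ⊢
  rw [forall_testBit_iff_of_lt (by omega)]
  omega

theorem holdsAt_called_iff (ht : t < clockPeriod d m) :
    (called : ClockVar d m).HoldsAt M p t w ↔ t = d + 1 + m + M.binaryNum p w := by
  have hpos := Nat.two_pow_pos m
  simp only [HoldsAt, Fin.val_last, clockPeriod] at ht ⊢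
  rw [forall_testBit_eq_iff_of_lt (by omega) (M.binaryNum_lt p w)]
  omega

theorem holdsAt_zero (X : ClockVar d m) :
    X.HoldsAt M p 0 w ↔ (clock d p).Holds M 0 X w := by
  cases X with
  | delay i =>
    cases i using Fin.cases <;> simp [HoldsAt, ClauseSystem.Holds, clock, KripkeModel.Sat]
  | _ => simp [HoldsAt, ClauseSystem.Holds, clock, KripkeModel.Sat]

theorem holds_iteration_iff_of_overflow (ht : t + 1 = clockPeriod d m) (X : ClockVar d m) :
    ((clock d p).iteration X).Holds M (HoldsAt M p t) w ↔ X.HoldsAt M p 0 w := by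
  have h_over : (overflow : ClockVar d m).HoldsAt M p t w :=
    (holdsAt_overflow_iff M p w (by omega)).2 ht
  have hdt : d < t := by
    have hpos := Nat.two_pow_pos m
    rw [clockPeriod] at ht
    omega
  cases X with
  | delay i =>
    cases i using Fin.cases with
    | zero => simpa [clock, HoldsAt] using h_over
    | succ i => simp [clock, HoldsAt, (i.2.trans hdt).ne']
  | _ =>
    simp only [clock, Schema.Holds, h_over]
    simp [HoldsAt]

theorem holds_iteration_iff_of_lt (ht : t + 1 < clockPeriod d m) (X : ClockVar d m) :
    ((clock d p).iteration X).Holds M (HoldsAt M p t) w ↔ X.HoldsAt M p (t + 1) w := by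
  have h_over : ¬ (overflow : ClockVar d m).HoldsAt M p t w := by
    rw [holdsAt_overflow_iff M p w (by omega)]; omega
  have h_start : d + 1 ≤ t ∨ t = d ↔ d ≤ t := by omega
  cases X with
  | delay i =>
    cases i using Fin.cases with
    | zero => simpa [clock, HoldsAt] using h_over
    | succ i => simp [clock, HoldsAt]
  | bit i =>
    simp only [clock, Schema.Holds, Schema.holds_cond, h_over]
    simp only [HoldsAt, Fin.val_castSucc]
    by_cases hi : d + 1 + i ≤ t
    · rw [Nat.sub_add_comm hi, testBit_succ_iff_not_iff_forall]
      tauto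
    · simp [Nat.sub_eq_zero_of_le (not_le.1 hi), Nat.sub_eq_zero_of_le (not_le.1 hi).le, hi]
  | carry i =>
    cases i using Fin.cases with
    | zero =>
      simp only [clock, Schema.Holds, Schema.holds_or, h_over, Fin.cases_zero]
      simpa [HoldsAt] using h_start
    | succ i =>
      simp only [clock, Schema.Holds, h_over, Fin.cases_succ]
      simp only [HoldsAt, Fin.val_castSucc, Fin.val_succ, ← Nat.add_assoc,
        Nat.add_le_add_iff_right, Nat.add_sub_add_right, Nat.forall_lt_succ_right]
      tauto
  | agree i =>
    cases i using Fin.cases with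
    | zero =>
      simp only [clock, Schema.Holds, Schema.holds_or, h_over, Fin.cases_zero]
      simpa [HoldsAt] using h_start
    | succ i =>
      simp only [clock, Schema.Holds, Schema.holds_cond, h_over, Fin.cases_succ,
        ← M.testBit_binaryNum_iff p w i]
      simp only [HoldsAt, Fin.val_castSucc, Fin.val_succ, ← Nat.add_assoc,
        Nat.add_le_add_iff_right, Nat.add_sub_add_right, Nat.forall_lt_succ_right]
      rw [Bool.eq_iff_iff (a := (t - (d + 1 + i)).testBit i) (b := (M.binaryNum p w).testBit i)]
      tauto

end ClockVar

theorem holds_clock_iff (n : ℕ) (X : ClockVar d m) (w : M.W) :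
    (clock d p).Holds M n X w ↔ X.HoldsAt M p (n % clockPeriod d m) w := by
  induction n generalizing X w with
  | zero => rw [Nat.zero_mod, ClockVar.holdsAt_zero]
  | succ n ih =>
    have hn : (clock d p).Holds M n = ClockVar.HoldsAt M p (n % clockPeriod d m) :=
      funext₂ fun Y x => propext (ih Y x)
    rw [ClauseSystem.Holds, hn, ← Nat.mod_add_mod]
    obtain h_lt | h_eq := (Nat.succ_le_of_lt (Nat.mod_lt n (clockPeriod_pos d m))).lt_or_eq
    · rw [ClockVar.holds_iteration_iff_of_lt M p w h_lt, Nat.mod_eq_of_lt h_lt]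
    · rw [ClockVar.holds_iteration_iff_of_overflow M p w h_eq, ← Nat.succ_eq_add_one, h_eq,
        Nat.mod_self]

theorem holds_clock_pulse_iff (n : ℕ) (w : M.W) :
    (clock d p).Holds M n .pulse w ↔ n % clockPeriod d m = d :=
  holds_clock_iff M p n _ w

theorem holds_clock_called_iff (n : ℕ) (w : M.W) :
    (clock d p).Holds M n .called w ↔ n % clockPeriod d m = d + 1 + m + M.binaryNum p w := by
  rw [holds_clock_iff, ClockVar.holdsAt_called_iff]
  exact Nat.mod_lt n (clockPeriod_pos d m)

end Clock

/-! ### Circuits -/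

theorem finset_sup_eq_true_iff {α : Type*} {s : Finset α} {f : α → Bool} :
    s.sup f = true ↔ ∃ a ∈ s, f a = true := by
  simpa using (Finset.sup_eq_bot_iff f s).not

namespace Circuit

variable {n k : ℕ} (C : Circuit n k)

section Value

variable (x : Fin n → Bool) {g : Fin C.size}

theorem value_of_input (hk : C.kind g = .input) :
    C.value x g = x (C.inputs.symm ⟨g, hk⟩) := by
  rw [value]
  split <;> simp_all

theorem value_and_iff (hk : C.kind g = .and) :
    C.value x g = true ↔ ∀ h ∈ C.child g, C.value x h = true := by
  rw [value]
  split <;> simp_all [← top_eq_true, Finset.inf_eq_top_iff]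

theorem value_or_iff (hk : C.kind g = .or) :
    C.value x g = true ↔ ∃ h ∈ C.child g, C.value x h = true := by
  rw [value]
  split <;> simp_all [finset_sup_eq_true_iff]

theorem value_not_iff (hk : C.kind g = .not) :
    C.value x g = true ↔ ¬ ∃ h ∈ C.child g, C.value x h = true := by
  rw [value]
  split <;> simp_all [← Bool.not_eq_true, finset_sup_eq_true_iff]

end Value

section Height

theorem height_lt_of_mem_child {g h : Fin C.size} (hg : h ∈ C.child g) :
    C.height h < C.height g := by
  rw [height.eq_def C g]
  exact Finset.le_sup (f := fun h : {h // h ∈ C.child g} => C.height h.1 + 1)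
    (Finset.mem_attach _ ⟨h, hg⟩)

theorem exists_height_eq_of_le (g : Fin C.size) {j : ℕ} (hj : j ≤ C.height g) :
    ∃ h, C.height h = j := by
  induction g using C.wf.induction with
  | h g ih =>
    obtain rfl | hj := hj.eq_or_lt
    · exact ⟨g, rfl⟩
    rw [height, Finset.lt_sup_iff] at hj
    obtain ⟨h, -, hj⟩ := hj
    exact ih h.1 h.2 (Nat.lt_succ_iff.1 hj)

theorem height_lt_size (g : Fin C.size) : C.height g < C.size := by
  have h_sub : Finset.range (C.height g + 1) ⊆ Finset.univ.image C.height := fun j hj => by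
    simpa using C.exists_height_eq_of_le g (Finset.mem_range_succ_iff.1 hj)
  simpa using (Finset.card_le_card h_sub).trans Finset.card_image_le

theorem depth_lt_size (h : 0 < C.size) : C.depth < C.size :=
  (Finset.sup_lt_iff h).2 fun _ _ => C.height_lt_size _

theorem height_outputs_le_depth (i : Fin k) : C.height (C.outputs i) ≤ C.depth :=
  Finset.le_sup (f := fun i : Fin k => C.height (C.outputs i)) (Finset.mem_univ i)

theorem inputs_le_size : n ≤ C.size := by
  simpa using Fintype.card_le_of_injective (fun i => (C.inputs i).1)
    (Subtype.val_injective.comp C.inputs.injective)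

theorem outputs_pos (h : 0 < C.size) : 0 < k := by
  have : Nonempty (Fin C.size) := ⟨⟨0, h⟩⟩
  obtain ⟨g, hg⟩ := Finite.exists_max C.height
  exact (C.outputs.symm ⟨g, fun h hh => (C.height_lt_of_mem_child hh).not_ge (hg h)⟩).pos

end Height

/-- The value of a gate in terms of the values of its children, where `inp i` is a schema for the
`i`th input and `X h` is a variable for the gate `h`. -/
noncomputable def gateSchema {P T : Type*} (inp : Fin n → Schema P T) (X : Fin C.size → T)
    (g : Fin C.size) : Schema P T :=
  match hk : C.kind g with
  | .input => inp (C.inputs.symm ⟨g, hk⟩)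
  | .and => .conj (C.child g) fun h => .var (X h)
  | .or => .disj (C.child g) fun h => .var (X h)
  | .not => .neg (.disj (C.child g) fun h => .var (X h))

theorem length_gateSchema_le {P T : Type*} {inp : Fin n → Schema P T}
    (h_inp : ∀ i, (inp i).length = 1) (X : Fin C.size → T) (g : Fin C.size) :
    (C.gateSchema inp X g).length ≤ 3 * (C.child g).card + 3 := by
  rw [gateSchema]
  split <;>
    simp only [h_inp, Schema.length, Schema.length_conj, Schema.length_disj, Finset.sum_const,
      smul_eq_mul] <;>
    omega

section Simulation

variable {PROP : Type v} {Pi : Finset PROP} {M : KripkeModel.{u} Pi} {T : Type*}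
  {inp : Fin n → Schema Pi T} {X : Fin C.size → T} {x : Fin n → Bool} {g : Fin C.size} {w : M.W}

theorem holds_gateSchema_iff {val : T → M.W → Prop}
    (h_inp : ∀ i, (inp i).Holds M val w ↔ x i = true)
    (h_child : ∀ h ∈ C.child g, val (X h) w ↔ C.value x h = true) :
    (C.gateSchema inp X g).Holds M val w ↔ C.value x g = true := by
  rw [gateSchema]
  split <;> rename_i hk
  · rw [C.value_of_input x hk, h_inp]
  · rw [C.value_and_iff x hk, Schema.holds_conj]
    exact forall₂_congr h_child
  · rw [C.value_or_iff x hk, Schema.holds_disj]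
    exact exists_congr fun h => and_congr_right (h_child h)
  · rw [C.value_not_iff x hk, Schema.Holds, Schema.holds_disj]
    exact not_congr (exists_congr fun h => and_congr_right (h_child h))

theorem holds_gate_iff_of_height_lt [LinearOrder PROP] {S : ClauseSystem Pi T}
    (hX : ∀ g, S.iteration (X g) = C.gateSchema inp X g) {s t : ℕ}
    (h_inp : ∀ r < t, ∀ i, (inp i).Holds M (S.Holds M (s + r)) w ↔ x i = true)
    (hg : C.height g < t) : S.Holds M (s + t) (X g) w ↔ C.value x g = true := by
  induction t generalizing g with
  | zero => exact absurd hg (Nat.not_lt_zero _)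
  | succ t ih =>
    rw [← Nat.add_assoc, ClauseSystem.Holds, hX]
    refine C.holds_gateSchema_iff (h_inp t t.lt_succ_self) fun h hh => ?_
    exact ih (fun r hr => h_inp r (hr.trans t.lt_succ_self))
      ((C.height_lt_of_mem_child hh).trans_le (Nat.lt_succ_iff.1 hg))

end Simulation

end Circuit

namespace MPC

variable {PROP : Type v} [LinearOrder PROP] {Pi : Finset PROP} {Delta : ℕ} (C : MPC Pi Delta)
  {T : Type*} (X : Fin (Delta + 1) → Fin C.k → T)

/-- The schemata for the input of the circuit if the variables `X` store the received strings. -/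
noncomputable def inputSchema : Fin (Pi.card + (Delta + 1) * C.k) → Schema Pi T :=
  Fin.append (fun i => .prop (Pi.orderIsoOfFin rfl i))
    fun i => .var (X (finProdFinEquiv.symm i).1 (finProdFinEquiv.symm i).2)

theorem length_inputSchema (i : Fin (Pi.card + (Delta + 1) * C.k)) :
    (C.inputSchema X i).length = 1 := by
  cases i using Fin.addCases <;> simp [inputSchema, Schema.length]

theorem holds_inputSchema_iff {M : KripkeModel.{u} Pi} {w : M.W} {val : T → M.W → Prop}
    {s : Fin (Delta + 1) → Fin C.k → Bool} (h : ∀ j b, val (X j b) w ↔ s j b = true)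
    (i : Fin (Pi.card + (Delta + 1) * C.k)) :
    (C.inputSchema X i).Holds M val w ↔ C.inputString (M.localInput w) s i = true := by
  cases i using Fin.addCases <;>
    simp [inputSchema, inputString, KripkeModel.localInput, h]

end MPC

/-! ### Identifiers as numbers -/

namespace KripkeModel

variable {PROP : Type v} [LinearOrder PROP] {Pi : Finset PROP}

/-- The symbol that gives the bit of weight `2 ^ i` of identifiers. The order of the distinguished
symbols is reversed because the first bit of an identifier is its most significant one. -/
noncomputable def identSymbol (ID : Set PROP) (i : Fin (distinguished ID Pi).card) : Pi :=
  ⟨(distinguished ID Pi).orderEmbOfFin rfl i.rev,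
    mem_of_mem_distinguished ((distinguished ID Pi).orderEmbOfFin_mem rfl i.rev)⟩

variable (M : KripkeModel.{u} Pi) (ID : Set PROP)

/-- The number of steps of the counter of the clock after which `w` is called. -/
noncomputable def callTime (w : M.W) : ℕ :=
  (distinguished ID Pi).card + M.binaryNum (identSymbol ID) w

theorem callTime_lt (w : M.W) :
    M.callTime ID w < (distinguished ID Pi).card + 2 ^ (distinguished ID Pi).card :=
  Nat.add_lt_add_left (M.binaryNum_lt _ w) _

theorem callTime_eq (w : M.W) : M.callTime ID w =
    (distinguished ID Pi).card + Nat.ofBits fun i => ofLex (M.ident ID w) i.rev :=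
  rfl

variable {M ID} {w x y : M.W}

theorem callTime_lt_callTime_iff :
    M.callTime ID x < M.callTime ID y ↔ M.ident ID x < M.ident ID y := by
  rw [callTime_eq, callTime_eq, Nat.add_lt_add_iff_left]
  exact (strictMono_ofBits_rev _).lt_iff_lt

theorem callTime_eq_callTime_iff :
    M.callTime ID x = M.callTime ID y ↔ M.ident ID x = M.ident ID y := by
  rw [callTime_eq, callTime_eq, Nat.add_right_inj]
  exact (strictMono_ofBits_rev _).injective.eq_iff

variable (M ID) in
/-- The number of successors of `w` that are called in the first `r` steps of the counter. -/
noncomputable def calledBefore (w : M.W) (r : ℕ) : ℕ :=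
  {y ∈ M.succ w | M.callTime ID y < r}.ncard

theorem isNeighbour_succ_iff {j : ℕ} : M.IsNeighbour ID w (j + 1) x ↔
    M.R w x ∧ M.calledBefore ID w (M.callTime ID x) = j := by
  simp only [IsNeighbour, calledBefore, callTime_lt_callTime_iff, Nat.add_right_cancel_iff]
  rfl

theorem calledBefore_zero : M.calledBefore ID w 0 = 0 := by
  simp [calledBefore]

theorem calledBefore_succ_of_not_exists {r : ℕ} (h : ¬ ∃ x, M.R w x ∧ M.callTime ID x = r) :
    M.calledBefore ID w (r + 1) = M.calledBefore ID w r := by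
  refine congrArg Set.ncard (Set.ext fun y => and_congr_right fun hy => ?_)
  have hyr : M.callTime ID y ≠ r := fun hyr => h ⟨y, hy, hyr⟩
  omega

theorem calledBefore_callTime_succ (h_inj : Set.InjOn (M.ident ID) (M.succ w)) (hx : M.R w x) :
    M.calledBefore ID w (M.callTime ID x + 1) = M.calledBefore ID w (M.callTime ID x) + 1 := by
  have h_finite : (M.succ w).Finite := .of_finite_image (Set.toFinite _) h_inj
  have h_insert : {y ∈ M.succ w | M.callTime ID y < M.callTime ID x + 1} =
      insert x {y ∈ M.succ w | M.callTime ID y < M.callTime ID x} := by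
    ext y
    have h_eq (hy : y ∈ M.succ w) : M.callTime ID y = M.callTime ID x ↔ y = x :=
      callTime_eq_callTime_iff.trans (h_inj.eq_iff hy hx)
    simp only [Set.mem_ofPred_eq, Set.mem_insert_iff, Nat.lt_succ_iff_lt_or_eq]
    grind [succ]
  rw [calledBefore, h_insert, Set.ncard_insert_of_notMem (by simp) (h_finite.sep _), calledBefore]

end KripkeModel

/-! ### The simulation -/

/-- The variables of `MPC.simulation`. -/
inductive SimVar (Delta k s d m : ℕ)
  /-- bit `b` of slot `j`, which is for the `j`th received string -/
  | stored (j : Fin (Delta + 1)) (b : Fin k)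
  /-- the value of the gate `g` -/
  | gate (g : Fin s)
  /-- exactly `j` successors have been called in the current period -/
  | flag (j : Fin (Delta + 1))
  /-- the variable `X` of the clock -/
  | timer (X : ClockVar d m)

namespace SimVar

variable {Delta k s d m : ℕ}

/-- The four kinds of variables as summands, which is how the variables are counted. -/
def equivSum (Delta k s d m : ℕ) : SimVar Delta k s d m ≃
    (Fin (Delta + 1) × Fin k ⊕ Fin s) ⊕ (Fin (Delta + 1) ⊕ ClockVar d m) where
  toFun
    | stored j b => .inl (.inl (j, b))
    | gate g => .inl (.inr g)
    | flag j => .inr (.inl j)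
    | timer X => .inr (.inr X)
  invFun := Sum.elim (Sum.elim (fun p => stored p.1 p.2) gate) (Sum.elim flag timer)
  left_inv X := by cases X <;> rfl
  right_inv := by rintro ((_ | _) | (_ | _)) <;> rfl

instance : Fintype (SimVar Delta k s d m) := .ofEquiv _ (equivSum Delta k s d m).symm

theorem card (Delta k s d m : ℕ) : Fintype.card (SimVar Delta k s d m) =
    (Delta + 1) * k + s + (Delta + 1) + Fintype.card (ClockVar d m) := by
  rw [Fintype.card_congr (equivSum Delta k s d m)]
  simp only [Fintype.card_sum, Fintype.card_prod, Fintype.card_fin]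
  omega

end SimVar

theorem add_mul_add_mod_eq_iff {a n r c Q : ℕ} (hr : r < Q) (hc : c < Q) :
    (a + n * Q + r) % Q = (a + c) % Q ↔ r = c := by
  rw [Nat.add_right_comm, Nat.add_mul_mod_self_right]
  refine ⟨fun h => ?_, fun h => by rw [h]⟩
  exact (Nat.ModEq.add_left_cancel' a h).eq_of_lt_of_lt hr hc

namespace MPC

variable {PROP : Type v} [LinearOrder PROP] {Pi : Finset PROP} {Delta : ℕ} (C : MPC Pi Delta)
  (ID : Set PROP)

/-- The variables of the simulation of `C`. The delay chain of the clock is long enough for all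
output gates to settle. -/
noncomputable abbrev Var : Type :=
  SimVar Delta C.k C.circuit.size (C.circuit.depth + 1) (distinguished ID Pi).card

/-- The number of steps in which the simulation performs one communication round of `C`. -/
noncomputable abbrev period : ℕ := clockPeriod (C.circuit.depth + 1) (distinguished ID Pi).card

omit [LinearOrder PROP] in
theorem depth_succ_lt_period : C.circuit.depth + 1 < C.period ID := by
  have h_pos := Nat.two_pow_pos (distinguished ID Pi).card
  simp only [period, clockPeriod]
  omega

open Schema SimVar ClockVar in
/-- A system of clauses that simulates `C`. At the pulse, the values of the output gates become the
new state in slot `0`. While the counter of the clock is running, slot `j ≥ 1` receives the state of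
the `j`th successor to be called, which is the `j`th neighbour. -/
noncomputable def simulation : ClauseSystem Pi (C.Var ID) where
  terminal
    | timer X => (clock (C.circuit.depth + 1) (KripkeModel.identSymbol (Pi := Pi) ID)).terminal X
    | _ => neg top
  iteration
    | stored j b => Fin.cases (motive := fun _ => Schema Pi (C.Var ID))
        (cond (var (timer pulse)) (var (gate (C.circuit.outputs b))) (var (stored 0 b)))
        (fun j => and (neg (var (timer pulse))) (or (var (stored j.succ b))
          (and (var (flag j.castSucc)) (dia (and (var (timer called)) (var (stored 0 b))))))) j
    | gate g => C.circuit.gateSchema (C.inputSchema stored) gate g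
    | flag j => Fin.cases (motive := fun _ => Schema Pi (C.Var ID))
        (or (var (timer pulse)) (and (var (flag 0)) (neg (dia (var (timer called))))))
        (fun j => and (neg (var (timer pulse)))
          (cond (dia (var (timer called))) (var (flag j.castSucc)) (var (flag j.succ)))) j
    | timer X =>
      ((clock (C.circuit.depth + 1) (KripkeModel.identSymbol (Pi := Pi) ID)).iteration X).subst
        fun Y => var (timer Y)

section Semantics

open SimVar ClockVar

variable (M : KripkeModel.{u} Pi)

/-- The truth value of the variable `X` of the simulation of `C` at `w` in round `t`. -/
abbrev SimHolds (t : ℕ) (X : C.Var ID) (w : M.W) : Prop :=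
  (C.simulation ID).Holds M t X w

theorem simHolds_pulse_iff (t : ℕ) (w : M.W) :
    C.SimHolds ID M t (timer pulse) w ↔ t % C.period ID = C.circuit.depth + 1 :=
  (ClauseSystem.holds_map_iff M timer (fun _ => rfl) (fun _ => rfl) t pulse w).trans
    (holds_clock_pulse_iff M (KripkeModel.identSymbol ID) t w)

theorem simHolds_called_iff (t : ℕ) (w : M.W) :
    C.SimHolds ID M t (timer called) w ↔
      t % C.period ID = C.circuit.depth + 2 + M.callTime ID w :=
  (ClauseSystem.holds_map_iff M timer (fun _ => rfl) (fun _ => rfl) t called w).trans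
    ((holds_clock_called_iff M (KripkeModel.identSymbol ID) t w).trans
      (by rw [KripkeModel.callTime, ← Nat.add_assoc]))

section Step

variable (t : ℕ) (w : M.W)

theorem simHolds_state_succ_iff (b : Fin C.k) :
    C.SimHolds ID M (t + 1) (stored 0 b) w ↔
      (C.SimHolds ID M t (timer pulse) w ∧
        C.SimHolds ID M t (gate (C.circuit.outputs b)) w) ∨
      (¬ C.SimHolds ID M t (timer pulse) w ∧ C.SimHolds ID M t (stored 0 b) w) :=
  Schema.holds_cond

theorem simHolds_slot_succ_iff (j : Fin Delta) (b : Fin C.k) :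
    C.SimHolds ID M (t + 1) (stored j.succ b) w ↔
      ¬ C.SimHolds ID M t (timer pulse) w ∧
        (C.SimHolds ID M t (stored j.succ b) w ∨
          (C.SimHolds ID M t (flag j.castSucc) w ∧
            ∃ x, M.R w x ∧ C.SimHolds ID M t (timer called) x ∧
              C.SimHolds ID M t (stored 0 b) x)) :=
  and_congr_right fun _ => Schema.holds_or

theorem simHolds_flag_zero_succ_iff :
    C.SimHolds ID M (t + 1) (flag 0) w ↔
      C.SimHolds ID M t (timer pulse) w ∨
        (C.SimHolds ID M t (flag 0) w ∧
          ¬ ∃ x, M.R w x ∧ C.SimHolds ID M t (timer called) x) :=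
  Schema.holds_or

theorem simHolds_flag_succ_succ_iff (j : Fin Delta) :
    C.SimHolds ID M (t + 1) (flag j.succ) w ↔
      ¬ C.SimHolds ID M t (timer pulse) w ∧
        (((∃ x, M.R w x ∧ C.SimHolds ID M t (timer called) x) ∧
            C.SimHolds ID M t (flag j.castSucc) w) ∨
          ((¬ ∃ x, M.R w x ∧ C.SimHolds ID M t (timer called) x) ∧
            C.SimHolds ID M t (flag j.succ) w)) :=
  and_congr_right fun _ => Schema.holds_cond

end Step

/-- The time at which the simulation has computed the states of round `n`. -/
noncomputable abbrev roundTime (n : ℕ) : ℕ := C.circuit.depth + 2 + n * C.period ID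

theorem simHolds_pulse_roundTime_add_iff {n r : ℕ} (hr : r < C.period ID) (w : M.W) :
    C.SimHolds ID M (C.roundTime ID n + r) (timer pulse) w ↔ r + 1 = C.period ID := by
  have h_lt := C.depth_succ_lt_period ID
  have h_mod : (C.circuit.depth + 2 + (C.period ID - 1)) % C.period ID = C.circuit.depth + 1 := by
    rw [show C.circuit.depth + 2 + (C.period ID - 1) = C.circuit.depth + 1 + C.period ID by omega,
      Nat.add_mod_right, Nat.mod_eq_of_lt h_lt]
  rw [simHolds_pulse_iff, ← h_mod, add_mul_add_mod_eq_iff hr (by omega)]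
  omega

theorem simHolds_called_roundTime_add_iff {n r : ℕ} (hr : r < C.period ID) (w : M.W) :
    C.SimHolds ID M (C.roundTime ID n + r) (timer called) w ↔ M.callTime ID w = r := by
  have h_lt : C.circuit.depth + 2 + M.callTime ID w < C.period ID :=
    Nat.add_lt_add_left (M.callTime_lt ID w) _
  rw [simHolds_called_iff, ← Nat.mod_eq_of_lt h_lt, add_mul_add_mod_eq_iff hr (by omega), eq_comm]

/-- The configuration of the simulation in round `t`, if this is step `r` of the counter and slot
`0` contains the states `f`. -/
structure Collecting (t r : ℕ) (f : M.W → Fin C.k → Bool) : Prop where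
  state_iff : ∀ w b, C.SimHolds ID M t (stored 0 b) w ↔ f w b = true
  flag_iff : ∀ w j, C.SimHolds ID M t (flag j) w ↔ M.calledBefore ID w r = j
  slot_iff : ∀ w (j : Fin Delta) b, C.SimHolds ID M t (stored j.succ b) w ↔
    ∃ x, M.callTime ID x < r ∧ M.IsNeighbour ID w (j + 1) x ∧ f x b = true

variable {C ID M} {t r n : ℕ} {f : M.W → Fin C.k → Bool}

theorem Collecting.stored_iff_received (h : C.Collecting ID M t r f)
    (hr : (distinguished ID Pi).card + 2 ^ (distinguished ID Pi).card ≤ r) (w : M.W)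
    (j : Fin (Delta + 1)) (b : Fin C.k) :
    C.SimHolds ID M t (stored j b) w ↔ C.received ID M f w j b = true := by
  cases j using Fin.cases with
  | zero => simp [received, h.state_iff]
  | succ j => simp [received, h.slot_iff, fun x => (M.callTime_lt ID x).trans_le hr]

theorem flag_succ_iff (h_inj : ∀ w, Set.InjOn (M.ident ID) (M.succ w))
    (h : C.Collecting ID M t r f) (h_pulse : ∀ w, ¬ C.SimHolds ID M t (timer pulse) w)
    (h_called : ∀ w, C.SimHolds ID M t (timer called) w ↔ M.callTime ID w = r) (w : M.W)
    (j : Fin (Delta + 1)) :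
    C.SimHolds ID M (t + 1) (flag j) w ↔ M.calledBefore ID w (r + 1) = j := by
  have h_count : (∃ x, M.R w x ∧ M.callTime ID x = r) ∧
        M.calledBefore ID w (r + 1) = M.calledBefore ID w r + 1 ∨
      (¬ ∃ x, M.R w x ∧ M.callTime ID x = r) ∧
        M.calledBefore ID w (r + 1) = M.calledBefore ID w r := by
    by_cases hx : ∃ x, M.R w x ∧ M.callTime ID x = r
    · obtain ⟨x, hwx, rfl⟩ := hx
      exact .inl ⟨⟨x, hwx, rfl⟩, KripkeModel.calledBefore_callTime_succ (h_inj w) hwx⟩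
    · exact .inr ⟨hx, KripkeModel.calledBefore_succ_of_not_exists hx⟩
  cases j using Fin.cases with
  | zero =>
    simp only [simHolds_flag_zero_succ_iff, h_pulse, h_called, h.flag_iff, Fin.val_zero]
    grind
  | succ j =>
    simp only [simHolds_flag_succ_succ_iff, h_pulse, h_called, h.flag_iff, Fin.val_castSucc,
      Fin.val_succ]
    grind

theorem slot_succ_iff (h : C.Collecting ID M t r f)
    (h_pulse : ∀ w, ¬ C.SimHolds ID M t (timer pulse) w)
    (h_called : ∀ w, C.SimHolds ID M t (timer called) w ↔ M.callTime ID w = r) (w : M.W)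
    (j : Fin Delta) (b : Fin C.k) :
    C.SimHolds ID M (t + 1) (stored j.succ b) w ↔
      ∃ x, M.callTime ID x < r + 1 ∧ M.IsNeighbour ID w (j + 1) x ∧ f x b = true := by
  simp only [simHolds_slot_succ_iff, h_pulse, h_called, h.flag_iff, h.slot_iff, h.state_iff,
    Fin.val_castSucc, KripkeModel.isNeighbour_succ_iff, Nat.lt_succ_iff_lt_or_eq]
  grind

theorem Collecting.succ (h_inj : ∀ w, Set.InjOn (M.ident ID) (M.succ w))
    (h : C.Collecting ID M t r f) (h_pulse : ∀ w, ¬ C.SimHolds ID M t (timer pulse) w)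
    (h_called : ∀ w, C.SimHolds ID M t (timer called) w ↔ M.callTime ID w = r) :
    C.Collecting ID M (t + 1) (r + 1) f where
  state_iff w b := by
    simp [simHolds_state_succ_iff, h_pulse, h.state_iff]
  flag_iff := flag_succ_iff h_inj h h_pulse h_called
  slot_iff := slot_succ_iff h h_pulse h_called

theorem Collecting.add (h_inj : ∀ w, Set.InjOn (M.ident ID) (M.succ w))
    (h : C.Collecting ID M (C.roundTime ID n) 0 f) (hr : r < C.period ID) :
    C.Collecting ID M (C.roundTime ID n + r) r f := by
  induction r with
  | zero => exact h
  | succ r ih =>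
    have hr' : r < C.period ID := r.lt_succ_self.trans hr
    refine (ih hr').succ h_inj (fun w => ?_) (C.simHolds_called_roundTime_add_iff ID M hr')
    exact (C.simHolds_pulse_roundTime_add_iff ID M hr' w).not.2 hr.ne

theorem collecting_of_pulse {v : M.W → Fin (Delta + 1) → Fin C.k → Bool}
    (h_stored : ∀ i ≤ C.circuit.depth, ∀ w j b,
      C.SimHolds ID M (t + i) (stored j b) w ↔ v w j b = true)
    (h_pulse : ∀ w, C.SimHolds ID M (t + (C.circuit.depth + 1)) (timer pulse) w) :
    C.Collecting ID M (t + (C.circuit.depth + 1) + 1) 0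
      fun w => C.circuit.eval (C.inputString (M.localInput w) (v w)) where
  state_iff w b := by
    simp only [simHolds_state_succ_iff, h_pulse, true_and, not_true, false_and, or_false]
    refine C.circuit.holds_gate_iff_of_height_lt (fun _ => rfl) (fun i hi => ?_)
      (Nat.lt_succ_of_le (C.circuit.height_outputs_le_depth b))
    exact C.holds_inputSchema_iff stored (h_stored i (Nat.lt_succ_iff.1 hi) w)
  flag_iff w j := by
    cases j using Fin.cases <;>
      simp [simHolds_flag_zero_succ_iff, simHolds_flag_succ_succ_iff, h_pulse,
        KripkeModel.calledBefore_zero]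
  slot_iff w j b := by
    simp [simHolds_slot_succ_iff, h_pulse]

theorem not_simHolds_stored_of_lt (ht : t < C.circuit.depth + 2) (w : M.W) (j : Fin (Delta + 1))
    (b : Fin C.k) : ¬ C.SimHolds ID M t (stored j b) w := by
  induction t generalizing w j with
  | zero => simp [ClauseSystem.Holds, simulation, KripkeModel.Sat]
  | succ t ih =>
    have ih := ih (t.lt_succ_self.trans ht)
    have h_pulse : ¬ C.SimHolds ID M t (timer pulse) w := by
      have h_le := Nat.mod_le t (C.period ID)
      rw [simHolds_pulse_iff]
      omega
    cases j using Fin.cases <;>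
      simp [simHolds_state_succ_iff, simHolds_slot_succ_iff, h_pulse, ih]

theorem collecting_roundTime (h_inj : ∀ w, Set.InjOn (M.ident ID) (M.succ w)) (n : ℕ) :
    C.Collecting ID M (C.roundTime ID n) 0 (C.config ID M n) := by
  induction n with
  | zero =>
    have h_time : C.roundTime ID 0 = 0 + (C.circuit.depth + 1) + 1 := by simp [roundTime]
    rw [h_time]
    refine collecting_of_pulse (v := fun _ _ _ => false) (fun i hi w j b => ?_) fun w => ?_
    · simpa using not_simHolds_stored_of_lt (by omega) w j b
    · rw [simHolds_pulse_iff, Nat.zero_add, Nat.mod_eq_of_lt (C.depth_succ_lt_period ID)]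
  | succ n ih =>
    let q := (distinguished ID Pi).card + 2 ^ (distinguished ID Pi).card
    have h_period : C.period ID = C.circuit.depth + 2 + q := rfl
    have h_time : C.roundTime ID (n + 1) =
        C.roundTime ID n + q + (C.circuit.depth + 1) + 1 := by
      simp only [roundTime, Nat.add_one_mul]
      omega
    rw [h_time]
    refine collecting_of_pulse (v := C.received ID M (C.config ID M n)) (fun i hi w j b => ?_)
      fun w => ?_
    · rw [Nat.add_assoc]
      exact (ih.add h_inj (by omega)).stored_iff_received (Nat.le_add_right q i) w j b
    · rw [Nat.add_assoc, simHolds_pulse_roundTime_add_iff] <;> omega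

theorem simHolds_state_iff (h_inj : ∀ w, Set.InjOn (M.ident ID) (M.succ w)) (t : ℕ) (w : M.W)
    (b : Fin C.k) : C.SimHolds ID M (C.circuit.depth + 2 + t) (stored 0 b) w ↔
      C.config ID M (t / C.period ID) w b = true := by
  have h := (collecting_roundTime (C := C) h_inj (t / C.period ID)).add h_inj
    (Nat.mod_lt t (clockPeriod_pos _ _))
  rw [roundTime, Nat.add_assoc, Nat.div_add_mod'] at h
  exact h.state_iff w b

end Semantics

/-! ### The length of the simulation -/

theorem length_terminal_simulation_le (X : C.Var ID) :
    ((C.simulation ID).terminal X).length ≤ 2 := by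
  cases X with
  | timer X => exact length_terminal_clock_le (KripkeModel.identSymbol ID) X
  | _ => simp [simulation, Schema.length]

theorem length_iteration_simulation_le {c : ℕ} (hc : C.circuit.FanInLE c) (X : C.Var ID) :
    ((C.simulation ID).iteration X).length ≤ 3 * c + 17 := by
  cases X with
  | gate g =>
    refine (C.circuit.length_gateSchema_le (C.length_inputSchema _) _ g).trans ?_
    have h_card := hc g
    omega
  | timer X =>
    refine le_trans ?_ (Nat.le_add_left 17 _)
    simp only [simulation, Schema.length_subst_var]
    exact length_iteration_clock_le _ X
  | stored j b =>
    cases j using Fin.cases <;>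
      simp only [simulation, Fin.cases_zero, Fin.cases_succ, Schema.length, Schema.length_cond,
        Schema.length_or] <;> omega
  | flag j =>
    cases j using Fin.cases <;>
      simp only [simulation, Fin.cases_zero, Fin.cases_succ, Schema.length, Schema.length_cond,
        Schema.length_or] <;> omega

omit [LinearOrder PROP] in
theorem card_var_le (h : 0 < C.circuit.size) : Fintype.card (C.Var ID) ≤ 8 * C.circuit.size := by
  have h_k := C.circuit.outputs_pos h
  have h_inputs := C.circuit.inputs_le_size
  have h_depth := C.circuit.depth_lt_size h
  have h_slots : Delta + 1 ≤ (Delta + 1) * C.k := Nat.le_mul_of_pos_right _ h_k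
  have h_ident : (distinguished ID Pi).card ≤ Pi.card :=
    Finset.card_le_card fun _ => mem_of_mem_distinguished
  rw [SimVar.card, ClockVar.card]
  omega

end MPC

/-! ### The simulating program -/

namespace MPC

variable {PROP : Type v} {Pi : Finset PROP} {Delta : ℕ} (C : MPC Pi Delta) (ID : Set PROP)

/-- The variable of the simulation that represents a state bit of `C`. -/
noncomputable def stateVar : Fin C.k ↪ C.Var ID :=
  ⟨SimVar.stored 0, fun _ _ h => (SimVar.stored.inj h).2⟩

instance : Nonempty (C.Var ID) := ⟨.flag 0⟩

theorem roundTime_succ_le (n : ℕ) : C.roundTime ID n + 1 ≤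
    4 * (C.circuit.depth + 2 ^ (distinguished ID Pi).card) * (n + 1) := by
  have h_lt := Nat.lt_two_pow_self (n := (distinguished ID Pi).card)
  have h_period : C.period ID ≤ 4 * (C.circuit.depth + 2 ^ (distinguished ID Pi).card) := by
    simp only [period, clockPeriod]
    omega
  calc C.roundTime ID n + 1
      ≤ C.period ID * (n + 1) := by
        simp only [roundTime, period, clockPeriod]
        nlinarith
    _ ≤ _ := Nat.mul_le_mul_right _ h_period

variable [LinearOrder PROP]

/-- The simulation of `C` as a program, with the attention and print bits of `C`. -/
noncomputable def toProgram : MSCProgram Pi :=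
  (C.simulation ID).toProgram (ClauseSystem.exists_numbering_strictMono (C.stateVar ID)).choose
    (C.attention.map (C.stateVar ID)) (C.print.map (C.stateVar ID))

theorem length_toProgram_le {c : ℕ} (hc : C.circuit.FanInLE c) (h : 0 < C.circuit.size) :
    (C.toProgram ID).length ≤ (8 * (3 * c + 21)) * C.circuit.size := by
  have h_clauses (X : C.Var ID) : 1 + ((C.simulation ID).terminal X).length +
      (1 + ((C.simulation ID).iteration X).length) ≤ 3 * c + 21 := by
    have h_terminal := C.length_terminal_simulation_le ID X
    have h_iteration := C.length_iteration_simulation_le ID hc X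
    omega
  calc (C.toProgram ID).length
      ≤ Fintype.card (C.Var ID) * (3 * c + 21) := by
        rw [toProgram, ClauseSystem.length_toProgram]
        exact Finset.sum_le_card_nsmul _ _ _ fun X _ => h_clauses X
    _ ≤ 8 * C.circuit.size * (3 * c + 21) := Nat.mul_le_mul_right _ (C.card_var_le ID h)
    _ = 8 * (3 * c + 21) * C.circuit.size := by ring

section Outputs

variable {ID} {M : KripkeModel.{u} Pi} {n : ℕ} {s : List Bool}

open Classical in
theorem outputs_toProgram_iff (w : M.W) : (C.toProgram ID).Outputs M w n s ↔
    OutputsAt (fun t b => decide (C.SimHolds ID M t (.stored 0 b) w)) C.attention C.print n s :=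
  (C.simulation ID).outputs_toProgram_iff
    (ClauseSystem.exists_numbering_strictMono (C.stateVar ID)).choose_spec

open Classical in
theorem decide_simHolds_state_eq (h_inj : ∀ w, Set.InjOn (M.ident ID) (M.succ w)) (w : M.W)
    (t : ℕ) : (fun b => decide (C.SimHolds ID M (C.circuit.depth + 2 + t) (.stored 0 b) w)) =
      C.config ID M (t / C.period ID) w := by
  funext b
  rw [Bool.eq_iff_iff, decide_eq_true_iff, simHolds_state_iff h_inj]

variable {C}

open Classical in
theorem Outputs.toProgram (h_inj : ∀ w, Set.InjOn (M.ident ID) (M.succ w)) {w : M.W}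
    (h : C.Outputs ID M w n s) : (C.toProgram ID).Outputs M w (C.roundTime ID n) s :=
  (C.outputs_toProgram_iff w).2 <|
    outputsAt_add_mul (clockPeriod_pos _ _)
      (fun _ ht b => decide_eq_false (not_simHolds_stored_of_lt ht w 0 b))
      (C.decide_simHolds_state_eq h_inj w) h

open Classical in
theorem exists_outputs_of_outputs_toProgram
    (h_inj : ∀ w, Set.InjOn (M.ident ID) (M.succ w)) {w : M.W}
    (h : (C.toProgram ID).Outputs M w n s) : ∃ m, C.Outputs ID M w m s :=
  exists_outputsAt_of_dilation (clockPeriod_pos _ _)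
    (fun _ ht b => decide_eq_false (not_simHolds_stored_of_lt ht w 0 b))
    (C.decide_simHolds_state_eq h_inj w) ((C.outputs_toProgram_iff w).1 h)

end Outputs

end MPC

theorem mainTheorem1_general {PROP : Type v} [LinearOrder PROP] (ID : Set PROP) :
    ∃ (T : ℕ) (K : ℕ → ℕ), ∀ (Pi : Finset PROP) (Delta : ℕ) (C : MPC Pi Delta),
      ∃ L : MSCProgram Pi,
        (∀ M : KripkeModel.{u} Pi, (∀ w, Set.InjOn (M.ident ID) (M.succ w)) →
          ∀ (w : M.W) (s : List Bool), (∃ n, C.Outputs ID M w n s) ↔ ∃ n, L.Outputs M w n s) ∧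
        (∀ c : ℕ, C.circuit.FanInLE c → 0 < C.circuit.size →
          L.length ≤ K c * C.circuit.size) ∧
        (∀ M : KripkeModel.{u} Pi, (∀ w, Set.InjOn (M.ident ID) (M.succ w)) →
          ∀ (w : M.W) (n : ℕ) (s : List Bool), C.Outputs ID M w n s →
            ∃ n' : ℕ, L.Outputs M w n' s ∧
              n' + 1 ≤ T * (C.circuit.depth + 2 ^ (distinguished ID Pi).card) * (n + 1)) := by
  refine ⟨4, fun c => 8 * (3 * c + 21), fun Pi Delta C => ⟨C.toProgram ID, ?_, ?_, ?_⟩⟩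
  · exact fun M h_inj w s => ⟨fun ⟨n, h⟩ => ⟨C.roundTime ID n, h.toProgram h_inj⟩,
      fun ⟨n, h⟩ => MPC.exists_outputs_of_outputs_toProgram h_inj h⟩
  · exact fun c hc h_size => C.length_toProgram_le ID hc h_size
  · exact fun M h_inj w n s h =>
      ⟨C.roundTime ID n, h.toProgram h_inj, C.roundTime_succ_le ID n⟩

theorem mainTheorem1 {PROP : Type v} [LinearOrder PROP] (ID : Set PROP) :
    ∃ (T : ℕ) (K : ℕ → ℕ), ∀ (Pi : Finset PROP) (Delta : ℕ) (C : MPC Pi Delta),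
      ∃ L : MSCProgram Pi,
        MPC.Equivalent.{u} C ID L ∧
        (∀ c : ℕ, C.circuit.FanInLE c → 0 < C.circuit.size →
          L.length ≤ K c * C.circuit.size) ∧
        (∀ M : KripkeModel.{u} Pi, M.MemK ID Delta →
          ∀ (w : M.W) (n : ℕ) (s : List Bool), C.Outputs ID M w n s →
            ∃ n' : ℕ, L.Outputs M w n' s ∧
              n' + 1 ≤ T * (C.circuit.depth + 2 ^ (distinguished ID Pi).card) * (n + 1)) := by
  obtain ⟨T, K, h⟩ := mainTheorem1_general.{u} ID
  refine ⟨T, K, fun Pi Delta C => ?_⟩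
  obtain ⟨L, h_equiv, h_length, h_time⟩ := h Pi Delta C
  exact ⟨L, fun M hM => h_equiv M fun _ => hM.ident_injective.injOn, h_length,
    fun M hM => h_time M fun _ => hM.ident_injective.injOn⟩
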